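/- Let $N\ge 2$ and $\nu>0$. Let $C_N^B=\{x\in\mathbb R^N: x_1\ge x_2\ge\dots\ge x_N\ge 0\}$, let $W_N^B$ be its interior, and for $x\in W_N^B$ let $H_\nu(x)\in\mathbb R^N$ be the vector with the coordinates $$H_\nu(x)_i=\sum_{j\ne i}\Bigl(\frac1{x_i-x_j}+\frac1{x_i+x_j}\Bigr)+\frac{\nu}{x_i},\qquad i=1,\dots,N.$$ Then for each starting point $x_0\in C_N^B$ (boundary points included) there is a unique continuous function $x:[0,\infty)\to C_N^B$ with $x(0)=x_0$ such that $x(t)\in W_N^B$ for all $t>0$ and $x$ is differentiable on $(0,\infty)$ with $$\frac{dx(t)}{dt}=H_\nu(x(t))\qquad\text{for all } t>0.$$ -/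

import Mathlib

/-- The closed Weyl chamber of type `B_N`: all `x` with `x_1 ≥ x_2 ≥ ... ≥ x_N ≥ 0`. -/
def chamberB (N : ℕ) : Set (EuclideanSpace ℝ (Fin N)) :=
  {x | (∀ i j : Fin N, i ≤ j → x j ≤ x i) ∧ ∀ i : Fin N, 0 ≤ x i}

/-- The open Weyl chamber of type `B_N`, the interior of the closed one. -/
def openChamberB (N : ℕ) : Set (EuclideanSpace ℝ (Fin N)) :=
  interior (chamberB N)

/-- The open chamber consists of all `x` with `x_1 > x_2 > ... > x_N > 0`. -/
theorem mem_openChamberB_iff (N : ℕ) (x : EuclideanSpace ℝ (Fin N)) :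
    x ∈ openChamberB N ↔ (∀ i j : Fin N, i < j → x j < x i) ∧ ∀ i : Fin N, 0 < x i := by
  have key : ∀ v : EuclideanSpace ℝ (Fin N), x ∈ openChamberB N →
      ∃ ε : ℝ, 0 < ε ∧ x + ε • v ∈ chamberB N := by
    intro v hx
    have hc : Filter.Tendsto (fun ε : ℝ => x + ε • v) (nhdsWithin 0 (Set.Ioi 0)) (nhds x) := by
      have h : Continuous (fun ε : ℝ => x + ε • v) := by fun_prop
      simpa using (h.tendsto 0).mono_left nhdsWithin_le_nhds
    have h1 := hc.eventually (mem_interior_iff_mem_nhds.mp hx)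
    obtain ⟨ε, h2, h3⟩ := (h1.and self_mem_nhdsWithin).exists
    exact ⟨ε, h3, h2⟩
  constructor
  · intro hx
    constructor
    · intro i j hij
      obtain ⟨ε, hε, h⟩ := key (EuclideanSpace.single j 1) hx
      have := h.1 i j hij.le
      simp [hij.ne] at this
      linarith
    · intro i
      obtain ⟨ε, hε, h⟩ := key (EuclideanSpace.single i (-1)) hx
      have := h.2 i
      simp at this
      linarith
  · intro hx
    have hopen : IsOpen {y : EuclideanSpace ℝ (Fin N) |
        (∀ i j : Fin N, i < j → y j < y i) ∧ ∀ i : Fin N, 0 < y i} := by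
      simp only [Set.ofPred_and, Set.ofPred_forall]
      refine IsOpen.inter ?_ ?_
      · refine isOpen_iInter_of_finite fun i => isOpen_iInter_of_finite fun j =>
          isOpen_iInter_of_finite fun _ => isOpen_lt (by fun_prop) (by fun_prop)
      · exact isOpen_iInter_of_finite fun i => isOpen_lt (by fun_prop) (by fun_prop)
    refine mem_interior.mpr ⟨_, ?_, hopen, hx⟩
    intro y hy
    refine ⟨fun i j hij => ?_, fun i => (hy.2 i).le⟩
    rcases hij.eq_or_lt with h | h
    · exact (congrArg y h.symm).le
    · exact (hy.1 i j h).le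

/-- The vector field `H_ν` of the ODE of type `B_N`; its denominators do not vanish on the
open chamber, the only place where the ODE is imposed. -/
noncomputable def fieldB (N : ℕ) (ν : ℝ) (x : EuclideanSpace ℝ (Fin N)) :
    EuclideanSpace ℝ (Fin N) :=
  WithLp.toLp 2 fun i =>
    (∑ j ∈ Finset.univ.erase i, (1 / (x i - x j) + 1 / (x i + x j))) + ν / x i

/-- `x`, restricted to `[0, ∞)`, is a solution of `dx/dt = H_ν(x)` with start in `x₀`: it is a
continuous map from `[0, ∞)` to the closed chamber with `x(0) = x₀` which, for all `t > 0`, lies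
in the open chamber and satisfies the ODE. The values of `x` at negative times are irrelevant. -/
structure IsSolutionB (N : ℕ) (ν : ℝ) (x₀ : EuclideanSpace ℝ (Fin N))
    (x : ℝ → EuclideanSpace ℝ (Fin N)) : Prop where
  continuousOn : ContinuousOn x (Set.Ici 0)
  mem_chamber : ∀ t : ℝ, 0 ≤ t → x t ∈ chamberB N
  initial : x 0 = x₀
  mem_openChamber : ∀ t : ℝ, 0 < t → x t ∈ openChamberB N
  hasDerivAt : ∀ t : ℝ, 0 < t → HasDerivAt x (fieldB N ν (x t)) t

/-! The field is F(x) = ∑ m_k a_k / ⟪a_k, x⟫ with positive weights, the gradient of the concave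
function ∑ m_k log ⟪a_k, x⟫. Hence F is dissipative: ⟪F x - F y, x - y⟫ ≤ 0. So distances between
solutions do not increase, which gives uniqueness, and neither does the speed ‖F(x(t))‖.

The walls are controlled by the identity ∑ m_k + ⟪F x, z - x⟫ = ∑ m_k ⟪a_k, z⟫ / ⟪a_k, x⟫ for an
interior point z: bounds on the speed and on ‖z - x‖ bound every 1 / ⟪a_k, x⟫
(`mul_inner_le_sum_add_inner`). From an interior start, the flow of a truncated field therefore
never reaches the truncation (`exists_repulsiveFlow_of_forall_pos`).

A boundary start x₀ is approximated by x₀ + c z with c → 0; contraction makes these flows converge.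
Although their initial speeds may blow up, the decay of ‖x - z‖² bounds the speed after any positive
time uniformly (`norm_repulsiveField_le_of_pos_time`), so the limit stays off the walls and solves
the ODE (`exists_repulsiveFlow`). -/

open Set Filter Topology

/-! ### Repulsive fields: dissipativity, wall estimate, truncation. -/

section RepulsiveField

variable {E ι : Type*} [NormedAddCommGroup E] [InnerProductSpace ℝ E] [Fintype ι]

/-- The vector field `x ↦ ∑ k, m k * g ⟪a k, x⟫ • a k`. -/
noncomputable def repulsiveField (a : ι → E) (m : ι → ℝ) (g : ℝ → ℝ) (x : E) : E :=
  ∑ k, (m k * g (inner ℝ (a k) x)) • a k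

/-- The function `u ↦ 1 / u`, truncated at height `1 / ε`. -/
noncomputable def truncInv (ε u : ℝ) : ℝ := (max u ε)⁻¹

theorem truncInv_of_le {ε u : ℝ} (h : ε ≤ u) : truncInv ε u = u⁻¹ := by
  rw [truncInv, max_eq_left h]

theorem truncInv_nonneg {ε : ℝ} (hε : 0 < ε) (u : ℝ) : 0 ≤ truncInv ε u :=
  inv_nonneg.2 (hε.le.trans (le_max_right _ _))

theorem truncInv_le {ε : ℝ} (hε : 0 < ε) (u : ℝ) : truncInv ε u ≤ ε⁻¹ :=
  inv_anti₀ hε (le_max_right _ _)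

theorem truncInv_mul_self_le {ε : ℝ} (hε : 0 < ε) (u : ℝ) : truncInv ε u * u ≤ 1 := by
  have h : 0 < max u ε := hε.trans_le (le_max_right _ _)
  rw [truncInv, inv_mul_le_iff₀ h, mul_one]
  exact le_max_left _ _

theorem antitone_truncInv {ε : ℝ} (hε : 0 < ε) : Antitone (truncInv ε) := fun _ _ h =>
  inv_anti₀ (hε.trans_le (le_max_right _ _)) (max_le_max_right _ h)

theorem lipschitzWith_truncInv {ε : ℝ} (hε : 0 < ε) :
    LipschitzWith (Real.toNNReal (ε⁻¹ * ε⁻¹)) (truncInv ε) := by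
  refine LipschitzWith.of_dist_le_mul fun u v => ?_
  have hu : 0 < max u ε := hε.trans_le (le_max_right _ _)
  have hv : 0 < max v ε := hε.trans_le (le_max_right _ _)
  rw [Real.coe_toNNReal _ (by positivity), Real.dist_eq, Real.dist_eq, truncInv, truncInv,
    inv_sub_inv hu.ne' hv.ne', abs_div, abs_of_pos (mul_pos hu hv), div_eq_inv_mul, mul_inv,
    abs_sub_comm]
  exact mul_le_mul (mul_le_mul (inv_anti₀ hε (le_max_right _ _)) (inv_anti₀ hε (le_max_right _ _))
    (by positivity) (by positivity)) (abs_max_sub_max_le_abs _ _ _) (abs_nonneg _) (by positivity)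

variable {a : ι → E} {m : ι → ℝ} {g : ℝ → ℝ}

theorem inner_repulsiveField (x z : E) :
    inner ℝ (repulsiveField a m g x) z = ∑ k, m k * g (inner ℝ (a k) x) * inner ℝ (a k) z := by
  simp [repulsiveField, sum_inner, real_inner_smul_left]

theorem repulsiveField_congr {g' : ℝ → ℝ} {x : E}
    (h : ∀ k, g (inner ℝ (a k) x) = g' (inner ℝ (a k) x)) :
    repulsiveField a m g x = repulsiveField a m g' x := by
  simp [repulsiveField, h]

/-- Each wall contributes m_k (g u - g v)(u - v), nonpositive for antitone g. The set S covers both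
the truncated field (S = univ) and the singular one (S = Ioi 0). -/
theorem inner_repulsiveField_sub_nonpos {S : Set ℝ} (hm : ∀ k, 0 ≤ m k) (hg : AntitoneOn g S)
    {x y : E} (hx : ∀ k, inner ℝ (a k) x ∈ S) (hy : ∀ k, inner ℝ (a k) y ∈ S) :
    inner ℝ (repulsiveField a m g x - repulsiveField a m g y) (x - y) ≤ 0 := by
  rw [inner_sub_left, inner_repulsiveField, inner_repulsiveField, ← Finset.sum_sub_distrib]
  refine Finset.sum_nonpos fun k _ => ?_
  rw [inner_sub_right]
  have h : (g (inner ℝ (a k) x) - g (inner ℝ (a k) y)) * (inner ℝ (a k) x - inner ℝ (a k) y) ≤ 0 := by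
    rcases le_total (inner ℝ (a k) x) (inner ℝ (a k) y) with h | h
    · exact mul_nonpos_of_nonneg_of_nonpos (sub_nonneg.2 (hg (hx k) (hy k) h)) (sub_nonpos.2 h)
    · exact mul_nonpos_of_nonpos_of_nonneg (sub_nonpos.2 (hg (hy k) (hx k) h)) (sub_nonneg.2 h)
  nlinarith [mul_nonpos_of_nonneg_of_nonpos (hm k) h]

/-- If `g u * u ≤ 1`, each term of the field is controlled by its inner product with `z - x`. -/
theorem mul_inner_le_sum_add_inner (hm : ∀ k, 0 < m k) {x z : E}
    (hg0 : ∀ k, 0 ≤ g (inner ℝ (a k) x))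
    (hg1 : ∀ k, g (inner ℝ (a k) x) * inner ℝ (a k) x ≤ 1) (hz : ∀ k, 0 < inner ℝ (a k) z) (k : ι) :
    g (inner ℝ (a k) x) ≤
      (∑ k, m k + inner ℝ (repulsiveField a m g x) (z - x)) / (m k * inner ℝ (a k) z) := by
  rw [le_div_iff₀ (mul_pos (hm k) (hz k)), inner_repulsiveField, ← Finset.sum_add_distrib]
  calc g (inner ℝ (a k) x) * (m k * inner ℝ (a k) z)
      = m k * g (inner ℝ (a k) x) * inner ℝ (a k) z := by ring
    _ ≤ ∑ k, m k * g (inner ℝ (a k) x) * inner ℝ (a k) z :=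
        Finset.single_le_sum (f := fun k => m k * g (inner ℝ (a k) x) * inner ℝ (a k) z)
          (fun k _ => mul_nonneg (mul_nonneg (hm k).le (hg0 k)) (hz k).le) (Finset.mem_univ k)
    -- Termwise this is m_k g(u) u ≤ m_k with u = ⟪a k, x⟫.
    _ ≤ _ := Finset.sum_le_sum fun k _ => by
        rw [inner_sub_right]
        nlinarith [mul_le_mul_of_nonneg_left (hg1 k) (hm k).le]

theorem norm_repulsiveField_le (hm : ∀ k, 0 ≤ m k) {x : E} {b : ι → ℝ}
    (hg0 : ∀ k, 0 ≤ g (inner ℝ (a k) x)) (hb : ∀ k, g (inner ℝ (a k) x) ≤ b k) :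
    ‖repulsiveField a m g x‖ ≤ ∑ k, m k * b k * ‖a k‖ := by
  refine norm_sum_le_of_le _ fun k _ => ?_
  rw [norm_smul, Real.norm_of_nonneg (mul_nonneg (hm k) (hg0 k))]
  exact mul_le_mul_of_nonneg_right (mul_le_mul_of_nonneg_left (hb k) (hm k)) (norm_nonneg _)

theorem exists_lipschitzWith_repulsiveField {K : NNReal} (hg : LipschitzWith K g) :
    ∃ K', LipschitzWith K' (repulsiveField a m g) := by
  refine ⟨Real.toNNReal (∑ k, |m k| * (K * ‖a k‖) * ‖a k‖), LipschitzWith.of_dist_le_mul fun x y => ?_⟩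
  rw [Real.coe_toNNReal _ (Finset.sum_nonneg fun k _ => by positivity), dist_eq_norm,
    repulsiveField, repulsiveField, ← Finset.sum_sub_distrib, Finset.sum_mul]
  refine norm_sum_le_of_le _ fun k _ => ?_
  rw [← sub_smul, ← mul_sub, norm_smul, norm_mul, Real.norm_eq_abs]
  have h1 := hg.dist_le_mul (inner ℝ (a k) x) (inner ℝ (a k) y)
  rw [dist_eq_norm, dist_eq_norm, ← inner_sub_right] at h1
  have h2 := h1.trans (mul_le_mul_of_nonneg_left (norm_inner_le_norm (𝕜 := ℝ) (a k) (x - y)) K.2)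
  calc _ ≤ |m k| * (K * (‖a k‖ * ‖x - y‖)) * ‖a k‖ := by gcongr
    _ = _ := by rw [dist_eq_norm]; ring

end RepulsiveField

/-! ### Flows of dissipative fields. -/

section MonotoneFlow

variable {E : Type*} [NormedAddCommGroup E] [InnerProductSpace ℝ E]

/-- The derivative of ‖x - y‖² is twice the inner product in `h`. Only continuity is asked at the
endpoints of `D`, so a start on a singular wall is allowed. -/
theorem antitoneOn_norm_sub_of_inner_nonpos {D : Set ℝ} (hD : Convex ℝ D) {x y x' y' : ℝ → E}
    (hx : ContinuousOn x D) (hy : ContinuousOn y D)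
    (hx' : ∀ t ∈ interior D, HasDerivAt x (x' t) t) (hy' : ∀ t ∈ interior D, HasDerivAt y (y' t) t)
    (h : ∀ t ∈ interior D, inner ℝ (x' t - y' t) (x t - y t) ≤ 0) :
    AntitoneOn (fun t => ‖x t - y t‖) D := by
  have key : AntitoneOn (fun t => ‖x t - y t‖ ^ 2) D :=
    antitoneOn_of_hasDerivWithinAt_nonpos hD ((hx.sub hy).norm.pow 2)
      (fun t ht => ((hx' t ht).sub (hy' t ht)).norm_sq.hasDerivWithinAt)
      (fun t ht => by
        have := h t ht
        rw [real_inner_comm] at this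
        simp only [Pi.sub_apply]
        linarith)
  exact fun s hs t ht hst => (sq_le_sq₀ (norm_nonneg _) (norm_nonneg _)).1 (key hs ht hst)

/-- The speed of a solution of a dissipative autonomous ODE does not increase. -/
theorem antitoneOn_norm_of_inner_sub_nonpos {F : E → E} {T : ℝ} {x : ℝ → E}
    (hx : ∀ t ∈ Ico 0 T, HasDerivAt x (F (x t)) t)
    (h : ∀ s ∈ Ico 0 T, ∀ t ∈ Ico 0 T, inner ℝ (F (x s) - F (x t)) (x s - x t) ≤ 0) :
    AntitoneOn (fun t => ‖F (x t)‖) (Ico 0 T) := by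
  intro s hs t ht hst
  -- The time shift x(· + r) is again a solution, so ‖x(u + r) - x(u)‖ does not increase in u;
  -- divide by r and let r → 0+.
  refine le_of_tendsto_of_tendsto (hx t ht).tendsto_slope_zero_right.norm
    (hx s hs).tendsto_slope_zero_right.norm ?_
  filter_upwards [Ioo_mem_nhdsGT (sub_pos.2 ht.2)] with r hr
  rw [norm_smul, norm_smul]
  refine mul_le_mul_of_nonneg_left ?_ (norm_nonneg _)
  have hm : ∀ u ∈ Icc s t, u + r ∈ Ico 0 T := fun u hu =>
    ⟨by linarith [hs.1, hu.1, hr.1], by linarith [hr.2, hu.2]⟩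
  have hm' : ∀ u ∈ Icc s t, u ∈ Ico 0 T := fun u hu =>
    ⟨hs.1.trans hu.1, hu.2.trans_lt ht.2⟩
  have h1 : ∀ u ∈ Icc s t, HasDerivAt (fun u => x (u + r)) (F (x (u + r))) u := fun u hu =>
    (hx _ (hm u hu)).comp_add_const u r
  have h2 : ∀ u ∈ Icc s t, HasDerivAt x (F (x u)) u := fun u hu => hx _ (hm' u hu)
  exact antitoneOn_norm_sub_of_inner_nonpos (convex_Icc s t)
    (fun u hu => (h1 u hu).continuousAt.continuousWithinAt)
    (fun u hu => (h2 u hu).continuousAt.continuousWithinAt)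
    (fun u hu => h1 u (interior_subset hu)) (fun u hu => h2 u (interior_subset hu))
    (fun u hu => h _ (hm u (interior_subset hu)) _ (hm' u (interior_subset hu)))
    (left_mem_Icc.2 hst) (right_mem_Icc.2 hst) hst

theorem exists_forall_mem_Ico_hasDerivAt_of_lipschitzWith [CompleteSpace E] {F : E → E}
    {K : NNReal} (hF : LipschitzWith K F) {L : NNReal} (hL : ∀ x, ‖F x‖ ≤ L) (x₀ : E) {T : ℝ}
    (hT : 0 < T) : ∃ x : ℝ → E, x 0 = x₀ ∧ ∀ t ∈ Ico 0 T, HasDerivAt x (F (x t)) t := by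
  -- As the bound L is global, a ball of radius L * T suffices for the whole time T. Starting at -T
  -- makes the derivative at 0 two-sided.
  have hpl : IsPicardLindelof (fun _ => F) (tmin := -T) (tmax := T) ⟨0, by simp [hT.le]⟩ x₀
      (L * T.toNNReal) 0 L K :=
    { lipschitzOnWith := fun _ _ => hF.lipschitzOnWith
      continuousOn := fun _ _ => continuousOn_const
      norm_le := fun _ _ x _ => hL x
      mul_max_le := by simp [hT.le] }
  obtain ⟨x, hx0, hx⟩ := hpl.exists_eq_forall_mem_Icc_hasDerivWithinAt₀
  refine ⟨x, hx0, fun t ht => ?_⟩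
  have h1 : -T < t := by linarith [ht.1]
  exact (hx t ⟨h1.le, ht.2.le⟩).hasDerivAt (Icc_mem_nhds h1 ht.2)

end MonotoneFlow

/-! ### Existence and uniqueness for repulsive flows. -/

section RepulsiveFlow

variable {E ι : Type*} [NormedAddCommGroup E] [InnerProductSpace ℝ E] [Fintype ι]
  {a : ι → E} {m : ι → ℝ}

/-- Solutions starting in the open cone exist on every bounded time interval. -/
theorem exists_repulsiveFlow_of_forall_pos [CompleteSpace E] (hm : ∀ k, 0 < m k) {x₀ : E}
    (hx₀ : ∀ k, 0 < inner ℝ (a k) x₀) {T : ℝ} (hT : 0 < T) :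
    ∃ x : ℝ → E, x 0 = x₀ ∧ ∀ t ∈ Ico 0 T, (∀ k, 0 < inner ℝ (a k) (x t)) ∧
      HasDerivAt x (repulsiveField a m (·⁻¹) (x t)) t := by
  set M := ‖repulsiveField a m (·⁻¹) x₀‖ with hM
  -- Bound for the truncated reciprocals along the flow, from the wall estimate with z = x₀: speed
  -- at most M, displacement at most M * T. Choosing ε with ε * B k < 1 keeps the truncation
  -- inactive.
  set B : ι → ℝ := fun k => (∑ k, m k + M * (M * T)) / (m k * inner ℝ (a k) x₀) with hB
  obtain ⟨ε, hε, hεk⟩ : ∃ ε : ℝ, 0 < ε ∧ ∀ k, ε ≤ inner ℝ (a k) x₀ ∧ ε * B k < 1 := by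
    have h : ∀ᶠ ε in 𝓝[>] (0 : ℝ), ∀ k, ε ≤ inner ℝ (a k) x₀ ∧ ε * B k < 1 := by
      refine eventually_all.2 fun k => nhdsWithin_le_nhds ?_
      have hc : Tendsto (fun ε : ℝ => ε * B k) (𝓝 0) (𝓝 0) := by
        simpa using (continuous_mul_const (B k)).tendsto (0 : ℝ)
      exact (eventually_le_nhds (hx₀ k)).and (hc.eventually_lt_const one_pos)
    obtain ⟨ε, h1, h2⟩ := (h.and self_mem_nhdsWithin).exists
    exact ⟨ε, h2, h1⟩
  obtain ⟨K, hK⟩ := exists_lipschitzWith_repulsiveField (a := a) (m := m) (lipschitzWith_truncInv hε)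
  have hL : ∀ x, ‖repulsiveField a m (truncInv ε) x‖ ≤
      Real.toNNReal (∑ k, m k * ε⁻¹ * ‖a k‖) := fun x =>
    (norm_repulsiveField_le (fun k => (hm k).le) (fun k => truncInv_nonneg hε _)
      (fun k => truncInv_le hε _)).trans (Real.le_coe_toNNReal _)
  obtain ⟨x, hx0, hx⟩ := exists_forall_mem_Ico_hasDerivAt_of_lipschitzWith hK hL x₀ hT
  have h0 : (0 : ℝ) ∈ Ico 0 T := ⟨le_rfl, hT⟩
  have hspeed : ∀ t ∈ Ico 0 T, ‖repulsiveField a m (truncInv ε) (x t)‖ ≤ M := fun t ht => by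
    have := antitoneOn_norm_of_inner_sub_nonpos hx (fun s _ t _ => inner_repulsiveField_sub_nonpos
      (fun k => (hm k).le) ((antitone_truncInv hε).antitoneOn univ) (fun _ => mem_univ _)
      (fun _ => mem_univ _)) h0 ht ht.1
    refine this.trans_eq ?_
    simp only [hx0, hM]
    rw [repulsiveField_congr fun k => truncInv_of_le (hεk k).1]
  have hdist : ∀ t ∈ Ico 0 T, ‖x₀ - x t‖ ≤ M * T := fun t ht => by
    have := (convex_Ico 0 T).norm_image_sub_le_of_norm_hasDerivWithin_le
      (fun s hs => (hx s hs).hasDerivWithinAt) hspeed h0 ht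
    rw [hx0, norm_sub_rev] at this
    refine this.trans (mul_le_mul_of_nonneg_left ?_ (norm_nonneg _))
    rw [sub_zero, Real.norm_of_nonneg ht.1]
    exact ht.2.le
  have hpos : ∀ t ∈ Ico 0 T, ∀ k, ε < inner ℝ (a k) (x t) := fun t ht k => by
    have h1 := mul_inner_le_sum_add_inner hm (x := x t) (fun k => truncInv_nonneg hε _)
      (fun k => truncInv_mul_self_le hε _) hx₀ k
    have h2 : truncInv ε (inner ℝ (a k) (x t)) ≤ B k := by
      refine h1.trans (div_le_div_of_nonneg_right (add_le_add_right ?_ _)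
        (mul_pos (hm k) (hx₀ k)).le)
      exact (real_inner_le_norm _ _).trans
        (mul_le_mul (hspeed t ht) (hdist t ht) (norm_nonneg _) (norm_nonneg _))
    by_contra! h
    rw [truncInv, max_eq_right h] at h2
    have := mul_le_mul_of_nonneg_left h2 hε.le
    rw [mul_inv_cancel₀ hε.ne'] at this
    linarith [(hεk k).2]
  refine ⟨x, hx0, fun t ht => ⟨fun k => hε.trans (hpos t ht k), ?_⟩⟩
  rw [← repulsiveField_congr fun k => truncInv_of_le (hpos t ht k).le]
  exact hx t ht

theorem inner_repulsiveField_inv_sub_nonpos (hm : ∀ k, 0 < m k) {x y : E}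
    (hx : ∀ k, 0 < inner ℝ (a k) x) (hy : ∀ k, 0 < inner ℝ (a k) y) :
    inner ℝ (repulsiveField a m (·⁻¹) x - repulsiveField a m (·⁻¹) y) (x - y) ≤ 0 :=
  inner_repulsiveField_sub_nonpos (S := Ioi 0) (fun k => (hm k).le)
    (fun _ hu _ _ huv => inv_anti₀ hu huv) hx hy

/-- The instantaneous repulsion from the walls: after time `τ` the speed is bounded in terms of
the distance of the starting point from a fixed interior point `z`. -/
theorem norm_repulsiveField_le_of_pos_time (hm : ∀ k, 0 < m k) {z : E}
    (hz : ∀ k, 0 < inner ℝ (a k) z) {T : ℝ} {x : ℝ → E}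
    (hpos : ∀ t ∈ Ico 0 T, ∀ k, 0 < inner ℝ (a k) (x t))
    (hx : ∀ t ∈ Ico 0 T, HasDerivAt x (repulsiveField a m (·⁻¹) (x t)) t)
    {R : ℝ} (hR : ‖x 0 - z‖ ≤ R) {τ t : ℝ} (hτ : 0 < τ) (hτt : τ ≤ t) (htT : t < T) :
    ‖repulsiveField a m (·⁻¹) (x t)‖ ≤
      ∑ k, m k * ((∑ k, m k + R ^ 2 / (2 * τ)) / (m k * inner ℝ (a k) z)) * ‖a k‖ := by
  have hmem : ∀ s ∈ Icc 0 τ, s ∈ Ico 0 T := fun s hs => ⟨hs.1, (hs.2.trans hτt).trans_lt htT⟩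
  have hd : ∀ s ∈ Icc 0 τ, HasDerivAt (fun s => ‖x s - z‖ ^ 2)
      (2 * inner ℝ (x s - z) (repulsiveField a m (·⁻¹) (x s))) s := fun s hs =>
    ((hx s (hmem s hs)).sub_const z).norm_sq
  -- Since ‖x - z‖² starts at most at R² and stays nonnegative, its mean slope on [0, τ] is at least
  -- -R² / τ. At a time s attaining that slope the wall estimate bounds the speed, and the bound
  -- persists afterwards.
  obtain ⟨s, hs, hs'⟩ := exists_hasDerivAt_eq_slope _ _ hτ
    (fun s hs => (hd s hs).continuousAt.continuousWithinAt)
    (fun s hs => hd s (Ioo_subset_Icc_self hs))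
  have hsT := hmem s (Ioo_subset_Icc_self hs)
  have hin : inner ℝ (repulsiveField a m (·⁻¹) (x s)) (z - x s) ≤ R ^ 2 / (2 * τ) := by
    rw [real_inner_comm, ← neg_sub, inner_neg_left, le_div_iff₀ (by positivity)]
    rw [sub_zero, eq_div_iff hτ.ne'] at hs'
    have : ‖x 0 - z‖ ^ 2 ≤ R ^ 2 := pow_le_pow_left₀ (norm_nonneg _) hR 2
    nlinarith [sq_nonneg ‖x τ - z‖]
  have h1 := antitoneOn_norm_of_inner_sub_nonpos hx
    (fun s hs t ht => inner_repulsiveField_inv_sub_nonpos hm (hpos s hs) (hpos t ht)) hsT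
    ⟨(hτ.le.trans hτt), htT⟩ (hs.2.le.trans hτt)
  refine h1.trans (norm_repulsiveField_le (fun k => (hm k).le)
    (fun k => inv_nonneg.2 (hpos s hsT k).le) fun k => ?_)
  refine (mul_inner_le_sum_add_inner hm (fun k => inv_nonneg.2 (hpos s hsT k).le)
    (fun k => (inv_mul_cancel₀ (hpos s hsT k).ne').le) hz k).trans ?_
  exact div_le_div_of_nonneg_right (add_le_add_right hin _) (mul_pos (hm k) (hz k)).le

/-- Solutions starting in the closed cone exist and enter the open cone at once. -/
theorem exists_repulsiveFlow [CompleteSpace E] (hm : ∀ k, 0 < m k) {z : E} (hz : ∀ k, 0 < inner ℝ (a k) z)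
    {x₀ : E} (hx₀ : ∀ k, 0 ≤ inner ℝ (a k) x₀) :
    ∃ x : ℝ → E, ContinuousOn x (Ici 0) ∧ x 0 = x₀ ∧ ∀ t, 0 < t →
      (∀ k, 0 < inner ℝ (a k) (x t)) ∧ HasDerivAt x (repulsiveField a m (·⁻¹) (x t)) t := by
  set c : ℕ → ℝ := fun n => 1 / ((n : ℝ) + 1) with hc
  have hc0 : ∀ n, 0 < c n := fun n => Nat.one_div_pos_of_nat
  have hc1 : ∀ n, c n ≤ 1 := fun n => by
    rw [hc, div_le_one (by positivity)]
    linarith [n.cast_nonneg (α := ℝ)]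
  have hclim : Tendsto c atTop (𝓝 0) := tendsto_one_div_add_atTop_nhds_zero_nat
  -- The n-th approximation lives on [0, n + 1), so every bounded interval is eventually covered and
  -- no gluing is needed.
  have hex : ∀ n : ℕ, ∃ x : ℝ → E, x 0 = x₀ + c n • z ∧ ∀ t ∈ Ico 0 ((n : ℝ) + 1),
      (∀ k, 0 < inner ℝ (a k) (x t)) ∧ HasDerivAt x (repulsiveField a m (·⁻¹) (x t)) t := fun n => by
    refine exists_repulsiveFlow_of_forall_pos hm (fun k => ?_) (by positivity)
    rw [inner_add_right, real_inner_smul_right]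
    exact add_pos_of_nonneg_of_pos (hx₀ k) (mul_pos (hc0 n) (hz k))
  choose x hx0 hx using hex
  have hcontr : ∀ n p : ℕ, n ≤ p → ∀ t ∈ Ico 0 ((n : ℝ) + 1), ‖x n t - x p t‖ ≤ c n * ‖z‖ := by
    intro n p hnp t ht
    have hp : ∀ s ∈ Ico 0 ((n : ℝ) + 1), s ∈ Ico 0 ((p : ℝ) + 1) := fun s hs =>
      ⟨hs.1, hs.2.trans_le (by gcongr)⟩
    have h := antitoneOn_norm_sub_of_inner_nonpos (convex_Ico 0 ((n : ℝ) + 1))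
      (fun s hs => (hx n s hs).2.continuousAt.continuousWithinAt)
      (fun s hs => (hx p s (hp s hs)).2.continuousAt.continuousWithinAt)
      (fun s hs => (hx n s (interior_subset hs)).2)
      (fun s hs => (hx p s (hp s (interior_subset hs))).2)
      (fun s hs => inner_repulsiveField_inv_sub_nonpos hm (hx n s (interior_subset hs)).1
        (hx p s (hp s (interior_subset hs))).1) ⟨le_rfl, by positivity⟩ ht ht.1
    refine h.trans ?_
    simp only [hx0, add_sub_add_left_eq_sub, ← sub_smul, norm_smul]
    refine mul_le_mul_of_nonneg_right ?_ (norm_nonneg _)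
    have : c p ≤ c n := one_div_le_one_div_of_le (by positivity) (by gcongr)
    rw [Real.norm_of_nonneg (sub_nonneg.2 this)]
    linarith [hc0 p]
  have hczlim : Tendsto (fun n => c n * ‖z‖) atTop (𝓝 0) := by simpa using hclim.mul_const ‖z‖
  -- At negative times the limit gets the dummy value 0.
  have hlim : ∀ t, ∃ X, 0 ≤ t → Tendsto (fun n => x n t) atTop (𝓝 X) := fun t => by
    by_cases ht : 0 ≤ t
    · obtain ⟨n₀, hn₀⟩ := exists_nat_ge t
      have hcau : CauchySeq fun n => x (n + n₀) t := by
        refine cauchySeq_of_le_tendsto_0' (fun n => c (n + n₀) * ‖z‖) (fun n p hnp => ?_)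
          (hczlim.comp (tendsto_add_atTop_nat n₀))
        rw [dist_eq_norm]
        refine hcontr _ _ (by gcongr) t ⟨ht, ?_⟩
        push_cast
        linarith [n.cast_nonneg (α := ℝ)]
      obtain ⟨X, hX⟩ := cauchySeq_tendsto_of_complete hcau
      exact ⟨X, fun _ => (tendsto_add_atTop_iff_nat n₀).1 hX⟩
    · exact ⟨0, fun h => absurd h ht⟩
  choose X hX using hlim
  have hXdist : ∀ n : ℕ, ∀ t ∈ Ico 0 ((n : ℝ) + 1), ‖x n t - X t‖ ≤ c n * ‖z‖ := fun n t ht =>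
    le_of_tendsto ((tendsto_const_nhds.sub (hX t ht.1)).norm)
      (eventually_atTop.2 ⟨n, fun p hp => hcontr n p hp t ht⟩)
  have hunif : ∀ T : ℝ, TendstoUniformlyOn x X atTop (Ico 0 T) := fun T => by
    rw [Metric.tendstoUniformlyOn_iff]
    intro δ hδ
    filter_upwards [hczlim.eventually_lt_const hδ, eventually_ge_atTop ⌈T⌉₊] with n hn hnT t ht
    rw [dist_comm, dist_eq_norm]
    refine (hXdist n t ⟨ht.1, ht.2.trans ?_⟩).trans_lt hn
    linarith [Nat.ceil_le.1 hnT]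
  have hcont : ∀ T : ℝ, ContinuousOn X (Ico 0 T) := fun T => by
    refine (hunif T).continuousOn (Eventually.frequently ?_)
    filter_upwards [eventually_ge_atTop ⌈T⌉₊] with n hnT t ht
    refine (hx n t ⟨ht.1, ht.2.trans ?_⟩).2.continuousAt.continuousWithinAt
    linarith [Nat.ceil_le.1 hnT]
  have hcontI : ContinuousOn X (Ici 0) := fun t ht => by
    refine (hcont (t + 1) t ⟨ht, by linarith⟩).mono_of_mem_nhdsWithin ?_
    exact mem_nhdsWithin.2 ⟨Iio (t + 1), isOpen_Iio, by simp, fun s hs => ⟨hs.2, hs.1⟩⟩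
  refine ⟨X, hcontI, ?_, fun t ht => ?_⟩
  · refine tendsto_nhds_unique (hX 0 le_rfl) ?_
    simp only [hx0]
    simpa using tendsto_const_nhds.add (hclim.smul_const z)
  set τ := t / 2 with hτ
  set T := t + 1 with hT
  have hτ0 : 0 < τ := by positivity
  obtain ⟨R, hR⟩ : ∃ R, ∀ s ∈ Icc 0 T, ‖X s‖ ≤ R :=
    isCompact_Icc.exists_bound_of_continuousOn (hcontI.mono fun s hs => hs.1)
  have hR0 : 0 ≤ R := (norm_nonneg _).trans (hR 0 ⟨le_rfl, by positivity⟩)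
  -- A distance from the walls uniform in n, on a window around t away from 0: M bounds the speeds
  -- there, since ‖x n 0 - z‖ ≤ ‖x₀‖ + ‖z‖.
  obtain ⟨δ, hδ, hδx⟩ : ∃ δ : ℝ, 0 < δ ∧ ∀ n : ℕ, T ≤ n → ∀ s ∈ Ico τ T, ∀ k,
      δ ≤ inner ℝ (a k) (x n s) := by
    set M := ∑ k, m k * ((∑ k, m k + (‖x₀‖ + ‖z‖) ^ 2 / (2 * τ)) / (m k * inner ℝ (a k) z)) * ‖a k‖
      with hM
    set B : ι → ℝ := fun k => (∑ k, m k + M * (‖z‖ + ‖z‖ + R)) / (m k * inner ℝ (a k) z)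
    have hbound : ∀ n : ℕ, T ≤ n → ∀ s ∈ Ico τ T, ∀ k, (inner ℝ (a k) (x n s))⁻¹ ≤ B k := by
      intro n hn s hs k
      have hmem : s ∈ Ico 0 ((n : ℝ) + 1) := ⟨hτ0.le.trans hs.1, by linarith [hs.2]⟩
      have hpos := (hx n s hmem).1
      have h1 : ‖repulsiveField a m (·⁻¹) (x n s)‖ ≤ M := by
        refine norm_repulsiveField_le_of_pos_time hm hz (fun s hs => (hx n s hs).1)
          (fun s hs => (hx n s hs).2) ?_ hτ0 hs.1 hmem.2
        rw [hx0, add_sub_assoc]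
        refine (norm_add_le _ _).trans (add_le_add_right ?_ _)
        rw [show c n • z - z = (c n - 1) • z by module, norm_smul, Real.norm_eq_abs, abs_sub_comm,
          abs_of_nonneg (sub_nonneg.2 (hc1 n))]
        exact mul_le_of_le_one_left (norm_nonneg _) (by linarith [hc0 n])
      have h2 : ‖z - x n s‖ ≤ ‖z‖ + ‖z‖ + R := by
        have e : z - x n s = z - (x n s - X s) - X s := by abel
        rw [e]
        refine (norm_sub_le _ _).trans (add_le_add ((norm_sub_le _ _).trans (add_le_add_right ?_ _))
          (hR s ⟨hmem.1, hs.2.le⟩))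
        exact (hXdist n s hmem).trans (mul_le_of_le_one_left (norm_nonneg _) (hc1 n))
      refine (mul_inner_le_sum_add_inner hm (fun k => inv_nonneg.2 (hpos k).le)
        (fun k => (inv_mul_cancel₀ (hpos k).ne').le) hz k).trans ?_
      refine div_le_div_of_nonneg_right (add_le_add_right ?_ _) (mul_pos (hm k) (hz k)).le
      exact (real_inner_le_norm _ _).trans
        (mul_le_mul h1 h2 (norm_nonneg _) ((norm_nonneg _).trans h1))
    have hS : 0 < 1 + ∑ k, |B k| := by positivity
    refine ⟨(1 + ∑ k, |B k|)⁻¹, inv_pos.2 hS, fun n hn s hs k => ?_⟩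
    have hpos := (hx n s ⟨hτ0.le.trans hs.1, by linarith [hs.2]⟩).1 k
    rw [inv_le_comm₀ hS hpos]
    have := Finset.single_le_sum (f := fun k => |B k|) (fun k _ => abs_nonneg _) (Finset.mem_univ k)
    linarith [hbound n hn s hs k, le_abs_self (B k)]
  have hδX : ∀ s ∈ Ico τ T, ∀ k, δ ≤ inner ℝ (a k) (X s) := fun s hs k =>
    ge_of_tendsto (tendsto_const_nhds.inner (hX s (hτ0.le.trans hs.1)))
      (eventually_atTop.2 ⟨⌈T⌉₊, fun n hn => hδx n (Nat.ceil_le.1 hn) s hs k⟩)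
  have htI : t ∈ Ioo τ T := ⟨half_lt_self ht, lt_add_one t⟩
  refine ⟨fun k => hδ.trans_le (hδX t (Ioo_subset_Ico_self htI) k), ?_⟩
  -- On the window the field truncated at δ agrees with the true one along the approximations and
  -- the limit. Being Lipschitz, it carries uniform convergence over to the derivatives.
  obtain ⟨K, hK⟩ := exists_lipschitzWith_repulsiveField (a := a) (m := m) (lipschitzWith_truncInv hδ)
  have hder := hK.uniformContinuous.comp_tendstoUniformlyOn
    ((hunif T).mono fun s (hs : s ∈ Ioo τ T) => ⟨hτ0.le.trans hs.1.le, hs.2⟩)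
  have := hasDerivAt_of_tendstoUniformlyOn isOpen_Ioo hder (f := x) (g := X) ?_
    (fun s hs => hX s (hτ0.le.trans hs.1.le)) htI
  · rwa [Function.comp_apply, repulsiveField_congr fun k =>
      truncInv_of_le (hδX t (Ioo_subset_Ico_self htI) k)] at this
  · filter_upwards [eventually_ge_atTop ⌈T⌉₊] with n hn s hs
    have hn := Nat.ceil_le.1 hn
    rw [Function.comp_apply, repulsiveField_congr fun k =>
      truncInv_of_le (hδx n hn s (Ioo_subset_Ico_self hs) k)]
    exact (hx n s ⟨hτ0.le.trans hs.1.le, by linarith [hs.2]⟩).2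

theorem eqOn_of_repulsiveFlow (hm : ∀ k, 0 < m k) {x y : ℝ → E} (hxc : ContinuousOn x (Ici 0))
    (hyc : ContinuousOn y (Ici 0)) (h0 : x 0 = y 0)
    (hxp : ∀ t, 0 < t → ∀ k, 0 < inner ℝ (a k) (x t))
    (hyp : ∀ t, 0 < t → ∀ k, 0 < inner ℝ (a k) (y t))
    (hx : ∀ t, 0 < t → HasDerivAt x (repulsiveField a m (·⁻¹) (x t)) t)
    (hy : ∀ t, 0 < t → HasDerivAt y (repulsiveField a m (·⁻¹) (y t)) t) :
    EqOn x y (Ici 0) := by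
  have h := antitoneOn_norm_sub_of_inner_nonpos (convex_Ici 0) hxc hyc
    (fun t ht => hx t (by simpa using ht)) (fun t ht => hy t (by simpa using ht)) (fun t ht => by
      have ht : 0 < t := by simpa using ht
      exact inner_repulsiveField_inv_sub_nonpos hm (hxp t ht) (hyp t ht))
  intro t ht
  have := h self_mem_Ici ht ht
  simp only [h0, sub_self, norm_zero, norm_le_zero_iff] at this
  exact sub_eq_zero.1 this

end RepulsiveFlow

/-! ### The chamber of type B as a repulsive cone. -/

section TypeB

variable {N : ℕ}

/-- Index set of the walls of the chamber of type `B_N`: each wall `x_i = ± x_j` occurs twice. -/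
abbrev WallB (N : ℕ) : Type :=
  {p : Fin N × Fin N // p.1 ≠ p.2} ⊕ {p : Fin N × Fin N // p.1 ≠ p.2} ⊕ Fin N

/-- The normals of the walls, pointing into the chamber. -/
noncomputable def normalB (N : ℕ) : WallB N → EuclideanSpace ℝ (Fin N)
  | .inl p => if p.1.1 < p.1.2 then EuclideanSpace.single p.1.1 1 - EuclideanSpace.single p.1.2 1
      else EuclideanSpace.single p.1.2 1 - EuclideanSpace.single p.1.1 1
  | .inr (.inl p) => EuclideanSpace.single p.1.1 1 + EuclideanSpace.single p.1.2 1
  | .inr (.inr i) => EuclideanSpace.single i 1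

/-- The weights of the walls. -/
noncomputable def weightB (N : ℕ) (ν : ℝ) : WallB N → ℝ
  | .inl _ => 1 / 2
  | .inr (.inl _) => 1 / 2
  | .inr (.inr _) => ν

theorem weightB_pos {ν : ℝ} (hν : 0 < ν) (k : WallB N) : 0 < weightB N ν k := by
  rcases k with p | p | i <;> simp [weightB, hν]

theorem inner_normalB_inl (p : {p : Fin N × Fin N // p.1 ≠ p.2}) (x : EuclideanSpace ℝ (Fin N)) :
    inner ℝ (normalB N (.inl p)) x =
      if p.1.1 < p.1.2 then x p.1.1 - x p.1.2 else x p.1.2 - x p.1.1 := by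
  by_cases h : p.1.1 < p.1.2 <;>
    simp [normalB, h, inner_sub_left, EuclideanSpace.inner_single_left]

theorem inner_normalB_inr_inl (p : {p : Fin N × Fin N // p.1 ≠ p.2})
    (x : EuclideanSpace ℝ (Fin N)) :
    inner ℝ (normalB N (.inr (.inl p))) x = x p.1.1 + x p.1.2 := by
  simp [normalB, inner_add_left, EuclideanSpace.inner_single_left]

theorem inner_normalB_inr_inr (i : Fin N) (x : EuclideanSpace ℝ (Fin N)) :
    inner ℝ (normalB N (.inr (.inr i))) x = x i := by
  simp [normalB, EuclideanSpace.inner_single_left]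

theorem forall_inner_normalB_pos_iff {x : EuclideanSpace ℝ (Fin N)} :
    (∀ k, 0 < inner ℝ (normalB N k) x) ↔ x ∈ openChamberB N := by
  rw [mem_openChamberB_iff]
  constructor
  · refine fun h => ⟨fun i j hij => ?_, fun i => ?_⟩
    · simpa [inner_normalB_inl, hij] using h (.inl ⟨(i, j), hij.ne⟩)
    · simpa [inner_normalB_inr_inr] using h (.inr (.inr i))
  · rintro ⟨h1, h2⟩ (p | p | i)
    · rw [inner_normalB_inl]
      split_ifs with h
      · exact sub_pos.2 (h1 _ _ h)
      · exact sub_pos.2 (h1 _ _ (lt_of_le_of_ne (not_lt.1 h) p.2.symm))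
    · rw [inner_normalB_inr_inl]
      exact add_pos (h2 _) (h2 _)
    · rw [inner_normalB_inr_inr]
      exact h2 i

theorem inner_normalB_nonneg {x : EuclideanSpace ℝ (Fin N)} (hx : x ∈ chamberB N) (k : WallB N) :
    0 ≤ inner ℝ (normalB N k) x := by
  rcases k with p | p | i
  · rw [inner_normalB_inl]
    split_ifs with h
    · exact sub_nonneg.2 (hx.1 _ _ h.le)
    · exact sub_nonneg.2 (hx.1 _ _ (not_lt.1 h))
  · rw [inner_normalB_inr_inl]
    exact add_nonneg (hx.2 _) (hx.2 _)
  · rw [inner_normalB_inr_inr]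
    exact hx.2 i

/-- By `hf` the pairs (i, j) and (j, i) contribute equally, which cancels the weight 1/2. It is used
with s = -1 for 1 / (x_j - x_k) and s = 1 for 1 / (x_j + x_k). -/
theorem sum_subtype_ne_half_mul_single (i : Fin N) (f : Fin N → Fin N → ℝ) (s : ℝ)
    (hf : ∀ j k, s * f j k = f k j) :
    ∑ p : {p : Fin N × Fin N // p.1 ≠ p.2}, 1 / 2 * f p.1.1 p.1.2 *
      ((if i = p.1.1 then 1 else 0) + s * (if i = p.1.2 then 1 else 0)) =
      ∑ j ∈ Finset.univ.erase i, f i j := by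
  have h1 : ∑ p : {p : Fin N × Fin N // p.1 ≠ p.2}, 1 / 2 * f p.1.1 p.1.2 *
      ((if i = p.1.1 then 1 else 0) + s * (if i = p.1.2 then 1 else 0)) =
      ∑ j : Fin N, ∑ k : Fin N, if j ≠ k then 1 / 2 * f j k *
      ((if i = j then 1 else 0) + s * (if i = k then 1 else 0)) else 0 := by
    rw [← Fintype.sum_prod_type' (f := fun j k : Fin N => if j ≠ k then 1 / 2 * f j k *
      ((if i = j then 1 else 0) + s * (if i = k then 1 else 0)) else 0), ← Finset.sum_filter]
    exact (Finset.sum_subtype _ (by simp) (fun p : Fin N × Fin N => 1 / 2 * f p.1 p.2 *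
      ((if i = p.1 then 1 else 0) + s * (if i = p.2 then 1 else 0)))).symm
  have h2 : ∀ j k : Fin N, (if j ≠ k then 1 / 2 * f j k *
      ((if i = j then 1 else 0) + s * (if i = k then 1 else 0)) else 0) =
      (if i = j then if i ≠ k then 1 / 2 * f i k else 0 else 0) +
      (if i = k then if i ≠ j then 1 / 2 * f i j else 0 else 0) := by
    intro j k
    rw [← hf j i]
    split_ifs <;> subst_vars <;> first | contradiction | ring1 | grind
  rw [h1]
  simp only [h2, Finset.sum_add_distrib]
  rw [Finset.sum_comm]
  simp only [Finset.sum_ite_eq, Finset.mem_univ, if_true]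
  rw [← Finset.sum_add_distrib, ← Finset.filter_ne, Finset.sum_filter]
  refine Finset.sum_congr rfl fun k _ => ?_
  split_ifs <;> ring

theorem repulsiveField_normalB (ν : ℝ) (x : EuclideanSpace ℝ (Fin N)) :
    repulsiveField (normalB N) (weightB N ν) (·⁻¹) x = fieldB N ν x := by
  ext i
  have hA : ∑ p : {p : Fin N × Fin N // p.1 ≠ p.2}, weightB N ν (.inl p) *
      (inner ℝ (normalB N (.inl p)) x)⁻¹ * normalB N (.inl p) i =
      ∑ j ∈ Finset.univ.erase i, (x i - x j)⁻¹ := by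
    rw [← sum_subtype_ne_half_mul_single i (fun j k => (x j - x k)⁻¹) (-1)
      (fun j k => by rw [neg_one_mul, ← inv_neg, neg_sub])]
    refine Finset.sum_congr rfl fun p _ => ?_
    rw [inner_normalB_inl, weightB, normalB]
    by_cases h : p.1.1 < p.1.2
    · rw [if_pos h, if_pos h, PiLp.sub_apply, PiLp.single_apply, PiLp.single_apply]
      ring
    · rw [if_neg h, if_neg h, ← neg_sub (x p.1.1), inv_neg, PiLp.sub_apply, PiLp.single_apply,
        PiLp.single_apply]
      ring
  have hB : ∑ p : {p : Fin N × Fin N // p.1 ≠ p.2}, weightB N ν (.inr (.inl p)) *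
      (inner ℝ (normalB N (.inr (.inl p))) x)⁻¹ * normalB N (.inr (.inl p)) i =
      ∑ j ∈ Finset.univ.erase i, (x i + x j)⁻¹ := by
    rw [← sum_subtype_ne_half_mul_single i (fun j k => (x j + x k)⁻¹) 1
      (fun j k => by rw [one_mul, add_comm])]
    refine Finset.sum_congr rfl fun p _ => ?_
    rw [inner_normalB_inr_inl, weightB, normalB]
    simp [PiLp.single_apply]
  have hC : ∑ j : Fin N, weightB N ν (.inr (.inr j)) *
      (inner ℝ (normalB N (.inr (.inr j))) x)⁻¹ * normalB N (.inr (.inr j)) i = ν / x i := by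
    simp only [inner_normalB_inr_inr]
    simp [weightB, normalB, PiLp.single_apply, div_eq_mul_inv]
  simp only [repulsiveField, fieldB, Fintype.sum_sum_type, PiLp.add_apply, WithLp.ofLp_sum,
    Finset.sum_apply, PiLp.smul_apply, smul_eq_mul, hA, hB, hC, one_div, Finset.sum_add_distrib]
  ring

theorem openChamberB_nonempty (N : ℕ) : (openChamberB N).Nonempty := by
  -- The indices run from 0 to N - 1, so the coordinates are N, ..., 1, all positive.
  refine ⟨WithLp.toLp 2 fun i => (N : ℝ) - i, (mem_openChamberB_iff N _).2 ⟨fun i j hij => ?_,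
    fun i => ?_⟩⟩
  · have : (i : ℝ) < j := by exact_mod_cast hij
    simpa using this
  · simp

end TypeB

theorem mainTheorem2 (N : ℕ) (hN : 2 ≤ N) (ν : ℝ) (hν : 0 < ν)
    (x₀ : EuclideanSpace ℝ (Fin N)) (hx₀ : x₀ ∈ chamberB N) :
    ∃ x : ℝ → EuclideanSpace ℝ (Fin N), IsSolutionB N ν x₀ x ∧
      ∀ y : ℝ → EuclideanSpace ℝ (Fin N), IsSolutionB N ν x₀ y → Set.EqOn y x (Set.Ici 0) := by
  obtain ⟨z, hz⟩ := openChamberB_nonempty N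
  obtain ⟨x, hxc, hx0, hx⟩ := exists_repulsiveFlow (weightB_pos hν)
    (forall_inner_normalB_pos_iff.2 hz) (inner_normalB_nonneg hx₀)
  have hopen : ∀ t, 0 < t → x t ∈ openChamberB N := fun t ht =>
    forall_inner_normalB_pos_iff.1 (hx t ht).1
  refine ⟨x, ⟨hxc, fun t ht => ?_, hx0, hopen, fun t ht => ?_⟩, fun y hy => ?_⟩
  · rcases ht.eq_or_lt with rfl | ht
    · rwa [hx0]
    · exact interior_subset (hopen t ht)
  · rw [← repulsiveField_normalB]
    exact (hx t ht).2
  · refine eqOn_of_repulsiveFlow (weightB_pos hν) hy.continuousOn hxc (hy.initial.trans hx0.symm)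
      (fun t ht => forall_inner_normalB_pos_iff.2 (hy.mem_openChamber t ht))
      (fun t ht => (hx t ht).1) (fun t ht => ?_) (fun t ht => (hx t ht).2)
    rw [repulsiveField_normalB]
    exact hy.hasDerivAt t ht
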